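/- All graphs are finite, simple and undirected. A graph is chordal if it has no induced cycle of length greater than $3$. Spanning trees $T_1,\dots,T_m$ of a connected graph $G$ collectively $+c$-span $G$ if for all vertices $u,v$ of $G$ there is an $i$ with $\mathrm{dist}_{T_i}(u,v)\le \mathrm{dist}_G(u,v)+c$. A gadget is a connected graph $G$ with a root $r$ and at least two terminals different from $r$. A spanning tree $T$ of $G$ is fast connecting (FC) if $\mathrm{dist}_T(r,t)=\mathrm{dist}_G(r,t)$ for every terminal $t$. For a fixed $c$, $G$ is a $d$-gadget if for every collection $\mathcal T$ of at most $d$ FC trees of $G$ there are two distinct terminals $s,t$ with $\mathrm{dist}_T(s,t)>\mathrm{dist}_G(s,t)+c$ for all $T\in\mathcal T$. The tree of gadgets $H_D(G)$ of depth $D$ is defined as follows: $H_1(G)=G$, with root $r$; and $H_{D+1}(G)$, for $D\ge 1$, is obtained from $G$ by identifying each terminal $t$ of $G$ with the root of a separate copy of $H_D(G)$, the root of $H_{D+1}(G)$ being $r$. For $k\ge 0$ let $G_k$ be the gadget that consists of a complete graph $K_{k+2}$ on the vertices $r,1,\dots,k+1$, a vertex $t_0$ adjacent to $1,\dots,k+1$,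 and for each $i\in\{1,\dots,k+1\}$ a vertex $t_i$ adjacent to exactly $t_0$ and $i$; its root is $r$ and its terminals are $t_0,t_1,\dots,t_{k+1}$. Theorem. No constant number of spanning trees can collectively $+2$-span chordal graphs: for every integer $k\ge 0$ there is a connected chordal graph that is not collectively $+2$-spanned by any collection of at most $k$ of its spanning trees. More precisely, for every $k\ge 0$ the graph $G_k$ is chordal and is a $k$-gadget for $c=2$, and there is a $D_0\ge 1$ such that for all $D\ge D_0$ the graph $H_D(G_k)$ is connected and chordal, and no collection of at most $k$ spanning trees of $H_D(G_k)$ collectively $+2$-spans $H_D(G_k)$. -/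

import Mathlib

/-- A graph is chordal if it has no induced cycle of length greater than `3`. -/
def IsChordalGraph {V : Type*} (G : SimpleGraph V) : Prop :=
  ∀ n : ℕ, 4 ≤ n → IsEmpty (SimpleGraph.cycleGraph n ↪g G)

/-- `T` is a spanning tree of `G` (on the same vertex set, so it is spanning by typing). -/
def IsSpanningTreeOf {V : Type*} (T G : SimpleGraph V) : Prop :=
  T ≤ G ∧ T.IsTree

/-- The spanning trees in `𝒯` collectively `+c`-span `G`: every pair of vertices is joined in some
tree of `𝒯` by a path of length at most `c` plus their distance in `G`. -/
def CollectivelySpans {V : Type*} (G : SimpleGraph V) (𝒯 : Finset (SimpleGraph V)) (c : ℕ) : Prop :=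
  (∀ T ∈ 𝒯, IsSpanningTreeOf T G) ∧ ∀ u v : V, ∃ T ∈ 𝒯, T.dist u v ≤ G.dist u v + c

/-- `G` admits a system of (at most) `μ` collective additive tree `c`-spanners. -/
def AdmitsCollectiveTreeSpanners {V : Type*} (G : SimpleGraph V) (μ c : ℕ) : Prop :=
  ∃ 𝒯 : Finset (SimpleGraph V), 𝒯.card ≤ μ ∧ CollectivelySpans G 𝒯 c

/-- A finite connected graph with a root and at least two terminals different from the root. -/
structure RootedGadget (V : Type*) where
  graph : SimpleGraph V
  finite : Finite V
  connected : graph.Connected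
  root : V
  terminals : Set V
  root_notMem : root ∉ terminals
  nontrivial : terminals.Nontrivial

namespace RootedGadget

variable {V : Type*} (Γ : RootedGadget V)

/-- Fast Connecting trees: spanning trees that preserve all root-terminal distances. -/
def IsFCTree (T : SimpleGraph V) : Prop :=
  IsSpanningTreeOf T Γ.graph ∧ ∀ t ∈ Γ.terminals, T.dist Γ.root t = Γ.graph.dist Γ.root t

/-- `Γ` is a `d`-gadget (for the surplus `c`): for every collection of at most `d` FC trees there
is a pair of terminals that is not `+c`-spanned by any tree of the collection. -/
def IsDGadget (c d : ℕ) : Prop :=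
  ∀ 𝒯 : Finset (SimpleGraph V), 𝒯.card ≤ d → (∀ T ∈ 𝒯, Γ.IsFCTree T) →
    ∃ s ∈ Γ.terminals, ∃ t ∈ Γ.terminals, s ≠ t ∧
      ∀ T ∈ 𝒯, Γ.graph.dist s t + c < T.dist s t

/-- Addresses of the copies of the gadget in the tree of gadgets of depth `D`. The copy `[]` is the
root gadget, and the copy `t :: l` is the child of the copy `l` glued at its terminal `t`. -/
abbrev Address (D : ℕ) : Type _ := {l : List Γ.terminals // l.length < D}

/-- Vertices of the tree of gadgets of depth `D`: `none` is the root of the root gadget, and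
`some (l, v)` is the non-root vertex `v` of the copy `l`. The root of a non-root copy is
identified with a terminal of the parent copy, so it is not listed again. -/
abbrev TreeVertex (D : ℕ) : Type _ := Option (Γ.Address D × {v : V // v ≠ Γ.root})

/-- The vertex of the tree of gadgets that serves as the root of the copy `l`. -/
def copyRoot {D : ℕ} : Γ.Address D → Γ.TreeVertex D
  | ⟨[], _⟩ => none
  | ⟨t :: l, h⟩ =>
      some (⟨l, lt_trans (Nat.lt_succ_self _) h⟩, ⟨t.1, fun e => Γ.root_notMem (e ▸ t.2)⟩)

open Classical in
/-- The vertex of the tree of gadgets that represents the vertex `a` of the copy `l`. -/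
noncomputable def copyVertex {D : ℕ} (l : Γ.Address D) (a : V) : Γ.TreeVertex D :=
  if h : a = Γ.root then Γ.copyRoot l else some (l, ⟨a, h⟩)

theorem copyRoot_ne {D : ℕ} (l : Γ.Address D) (a : {v : V // v ≠ Γ.root}) :
    Γ.copyRoot l ≠ some (l, a) := by
  obtain ⟨l, hl⟩ := l
  cases l with
  | nil => simp [copyRoot]
  | cons t l =>
    intro h
    simp [copyRoot] at h

theorem copyVertex_injective {D : ℕ} (l : Γ.Address D) :
    Function.Injective (Γ.copyVertex l) := by
  intro a b h
  unfold copyVertex at h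
  split_ifs at h with ha hb hb
  · rw [ha, hb]
  · exact absurd h (Γ.copyRoot_ne l _)
  · exact absurd h.symm (Γ.copyRoot_ne l _)
  · simpa using h

/-- The complete tree of gadgets of depth `D` built from `Γ`: depth `1` is `Γ` itself, and in depth
`D + 1` every terminal of the root gadget is the root of a tree of gadgets of depth `D`.
Two vertices are adjacent if they are adjacent in some copy of `Γ`. -/
def treeOfGadgets (D : ℕ) : SimpleGraph (Γ.TreeVertex D) where
  Adj x y := ∃ (l : Γ.Address D) (a b : V),
    Γ.graph.Adj a b ∧ x = Γ.copyVertex l a ∧ y = Γ.copyVertex l b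
  symm := ⟨by
    rintro x y ⟨l, a, b, h, hx, hy⟩
    exact ⟨l, b, a, h.symm, hy, hx⟩⟩
  loopless := ⟨by
    rintro x ⟨l, a, b, h, hx, hy⟩
    exact h.ne (Γ.copyVertex_injective l (hx.symm.trans hy))⟩

end RootedGadget

/-- Vertices of the gadget `G_k`: the root `r`, the vertices `1, …, k+1` (here `node i`, indexed by
`Fin (k + 1)`), and the vertices `t_0` and `t_1, …, t_{k+1}` (here `ear i`). -/
inductive ChordalGadgetVertex (k : ℕ) : Type
  | r : ChordalGadgetVertex k
  | node (i : Fin (k + 1)) : ChordalGadgetVertex k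
  | t₀ : ChordalGadgetVertex k
  | ear (i : Fin (k + 1)) : ChordalGadgetVertex k

namespace ChordalGadgetVertex

/-- The edges of `G_k`, each listed in at least one orientation (loops are dropped below). -/
def edge {k : ℕ} : ChordalGadgetVertex k → ChordalGadgetVertex k → Prop
  | r, node _ => True
  | node _, node _ => True
  | t₀, node _ => True
  | ear _, t₀ => True
  | ear i, node j => i = j
  | _, _ => False

theorem finite (k : ℕ) : Finite (ChordalGadgetVertex k) := by
  let f : (Option (Fin (k + 1)) ⊕ Option (Fin (k + 1))) → ChordalGadgetVertex k := fun x =>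
    match x with
    | Sum.inl none => r
    | Sum.inl (some i) => node i
    | Sum.inr none => t₀
    | Sum.inr (some i) => ear i
  refine Finite.of_surjective f ?_
  rintro (_ | i | _ | i)
  · exact ⟨Sum.inl none, rfl⟩
  · exact ⟨Sum.inl (some i), rfl⟩
  · exact ⟨Sum.inr none, rfl⟩
  · exact ⟨Sum.inr (some i), rfl⟩

end ChordalGadgetVertex

open ChordalGadgetVertex in
/-- The gadget `G_k`: a complete graph on `r, 1, …, k+1`, a vertex `t_0` adjacent to `1, …, k+1`,
and for each `i` a vertex `t_i` adjacent to `t_0` and `i`. The root is `r` and the terminals are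
`t_0, t_1, …, t_{k+1}`. -/
def chordalGadget (k : ℕ) : RootedGadget (ChordalGadgetVertex k) where
  graph := SimpleGraph.fromRel edge
  finite := ChordalGadgetVertex.finite k
  connected := by
    have h : ∀ v, (SimpleGraph.fromRel (edge (k := k))).Reachable v (node 0) := by
      have hr : (SimpleGraph.fromRel (edge (k := k))).Adj r (node 0) := by
        simp [SimpleGraph.fromRel_adj, edge]
      have ht : (SimpleGraph.fromRel (edge (k := k))).Adj t₀ (node 0) := by
        simp [SimpleGraph.fromRel_adj, edge]
      rintro (_ | i | _ | i)
      · exact hr.reachable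
      · have hi : (SimpleGraph.fromRel (edge (k := k))).Adj (node i) r := by
          simp [SimpleGraph.fromRel_adj, edge]
        exact hi.reachable.trans hr.reachable
      · exact ht.reachable
      · have hi : (SimpleGraph.fromRel (edge (k := k))).Adj (ear i) t₀ := by
          simp [SimpleGraph.fromRel_adj, edge]
        exact hi.reachable.trans ht.reachable
    exact { preconnected := fun u v => (h u).trans (h v).symm, nonempty := ⟨r⟩ }
  root := r
  terminals := {v | v = t₀ ∨ ∃ i, v = ear i}
  root_notMem := by simp
  nontrivial := ⟨t₀, Or.inl rfl, ear 0, Or.inr ⟨0, rfl⟩, by simp⟩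

/-! A spanning tree of the tree of gadgets restricts to a spanning tree of every copy
(`isSpanningTreeOf_comap`), because all other copies collapse to single vertices under `proj`. The
root of each copy is a cut vertex, so the surplus of tree distance over graph distance adds up along
a descent (`dist_add_dist_le`).

A tree that is not FC on a copy loses at least 1 between the root and some terminal of that copy. If
every tree keeps failing within a bounded number of levels, descending through such terminals makes
each tree lose `c + 1` (`exists_descent`). Otherwise some tree is FC throughout a deep window. Let
`𝒜` be the trees known to be FC in the current window. The gadget property, applied at the top of
the window, gives terminals `s`, `t` that no tree of `𝒜` spans. Below `s`, either all remaining
trees can be made to lose `c + 1`, and then the vertex reached together with `t` defeats every tree,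
or another tree joins `𝒜` in a smaller window (`exists_unspanned_pair`). There are finitely many
trees, so this ends.

For `G_k`, each FC tree can serve only one of the `k + 1` pairs `t₀`, `ear i`, hence the `k`-gadget
property. Induced cycles cannot cross a cut vertex, hence chordality passes from the gadget to the
tree of gadgets. -/

/-! ### Walks, cut vertices and induced cycles -/

namespace SimpleGraph

/-- If `f` sends edges of `G` to edges of `G'` or collapses them, walks project without getting
longer. -/
theorem Walk.exists_length_le_of_adj_imp {V W : Type*} {G : SimpleGraph V} {G' : SimpleGraph W}
    {f : V → W} (hf : ∀ x y, G.Adj x y → f x = f y ∨ G'.Adj (f x) (f y)) {x y : V}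
    (p : G.Walk x y) : ∃ q : G'.Walk (f x) (f y), q.length ≤ p.length := by
  induction p with
  | nil => exact ⟨.nil, le_rfl⟩
  | @cons u v w h p ih =>
    obtain ⟨q, hq⟩ := ih
    rcases hf _ _ h with e | e
    · exact ⟨q.copy e.symm rfl, by simp; omega⟩
    · exact ⟨.cons e q, by simpa using hq⟩

/-- If every edge leaving `S` ends in `w`, then `w` lies between the vertices of `S` and those
outside of `S`. -/
theorem dist_add_dist_le_of_cut {V : Type*} {G : SimpleGraph V} {S : Set V} {w u v : V}
    (hS : ∀ x y, G.Adj x y → x ∈ S → y ∉ S → y = w) (huv : G.Reachable u v)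
    (hu : u ∈ S) (hv : v ∉ S) : G.dist u w + G.dist w v ≤ G.dist u v := by
  have key : ∀ {u v : V} (p : G.Walk u v), u ∈ S → v ∉ S →
      G.dist u w + G.dist w v ≤ p.length := by
    intro u v p hu hv
    induction p with
    | nil => exact absurd hu hv
    | @cons a b c h p ih =>
      by_cases hb : b ∈ S
      · have h1 := ih hb hv
        have h2 : G.dist a w ≤ G.dist b w + 1 := by
          by_cases hr : G.Reachable b w
          · obtain ⟨q, hq⟩ := hr.exists_walk_length_eq_dist
            simpa [hq] using dist_le (Walk.cons h q)
          -- Here `dist` takes its default value 0, so the bound is trivial.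
          · have : ¬ G.Reachable a w := fun h' => hr (h.symm.reachable.trans h')
            simp [dist_eq_zero_of_not_reachable this]
        simp only [Walk.length_cons]
        omega
      · obtain rfl := hS _ _ h hu hb
        have h1 := dist_le p
        have h2 := dist_le (Walk.cons h .nil)
        simp only [Walk.length_cons, Walk.length_nil] at h2 ⊢
        omega
  obtain ⟨p, hp⟩ := huv.exists_walk_length_eq_dist
  exact hp ▸ key p hu hv

/-- The cyclic neighbours of a vertex of an induced cycle of length at least `4` are two distinct
non-adjacent neighbours. -/
theorem Embedding.exists_neighbors_of_cycleGraph {V : Type*} {G : SimpleGraph V} {n : ℕ}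
    (hn : 4 ≤ n) (f : cycleGraph n ↪g G) (j : Fin n) :
    ∃ i k, G.Adj (f j) (f i) ∧ G.Adj (f j) (f k) ∧ f i ≠ f k ∧ ¬ G.Adj (f i) (f k) := by
  obtain ⟨n, rfl⟩ := Nat.exists_eq_add_of_le' hn
  -- The neighbours `j - 1` and `j + 1` differ by 2. They are distinct as 2 ≠ 0, and non-adjacent as
  -- 2 is neither 1 nor -1 modulo `n + 4`.
  have h2 : (1 + 1 : Fin (n + 4)) ≠ 0 := by
    simp [Fin.ext_iff, Fin.val_add, Nat.mod_eq_of_lt]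
  have h3 : (1 + 1 : Fin (n + 4)) ≠ 1 := by
    simp
  have h4 : (1 + 1 + 1 : Fin (n + 4)) ≠ 0 := by
    simp [Fin.ext_iff, Fin.val_add, Nat.mod_eq_of_lt]
  refine ⟨j - 1, j + 1, ?_, ?_, ?_, ?_⟩
  · rw [f.map_adj_iff, cycleGraph_adj]
    left; abel
  · rw [f.map_adj_iff, cycleGraph_adj]
    right; abel
  · rw [f.injective.ne_iff]
    intro h
    apply h2
    calc (1 + 1 : Fin (n + 4)) = (j + 1) - (j - 1) := by abel
      _ = 0 := by rw [h]; abel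
  · rw [f.map_adj_iff, cycleGraph_adj]
    rintro (h | h)
    · apply h4
      calc (1 + 1 + 1 : Fin (n + 4)) = 1 - ((j - 1) - (j + 1)) := by abel
        _ = 0 := by rw [h]; abel
    · apply h3
      calc (1 + 1 : Fin (n + 4)) = (j + 1) - (j - 1) := by abel
        _ = 1 := h

open Fin.CommRing Fin.NatCast in
/-- A cycle that meets a side `S` of a cut vertex `w` stays in that side. -/
theorem Embedding.cycleGraph_mem_or_eq_of_cut {V : Type*} {G : SimpleGraph V} {n : ℕ}
    (f : cycleGraph (n + 2) ↪g G) {S : Set V} {w : V} (hw : w ∉ S)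
    (hS : ∀ x y, G.Adj x y → x ∈ S → y ∉ S → y = w) {i : Fin (n + 2)} (hi : f i ∈ S)
    (j : Fin (n + 2)) : f j ∈ S ∨ f j = w := by
  have step : ∀ a, f a ≠ w → f (a + 1) ≠ w → (f a ∈ S ↔ f (a + 1) ∈ S) := by
    intro a h1 h2
    have h : G.Adj (f a) (f (a + 1)) := by
      rw [f.map_adj_iff, cycleGraph_adj]
      right; abel
    exact ⟨fun h3 => by_contra fun h4 => h2 (hS _ _ h h3 h4),
      fun h3 => by_contra fun h4 => h1 (hS _ _ h.symm h3 h4)⟩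
  have cast_sub : ∀ p a : Fin (n + 2), p + ((a - p : Fin (n + 2)).val : Fin (n + 2)) = a := by
    intro p a
    rw [Fin.cast_val_eq_self]; abel
  by_cases hp : ∃ p, f p = w
  · obtain ⟨p, hp⟩ := hp
    -- By injectivity the cycle meets `w` only at `p`, so removing `p` leaves a path along which
    -- membership in `S` is constant.
    have main : ∀ m : ℕ, m < n + 1 → (f (p + ((m + 1 : ℕ) : Fin (n + 2))) ∈ S ↔ f (p + 1) ∈ S) := by
      intro m
      induction m with
      | zero => simp
      | succ m ih =>
        intro hm
        rw [← ih (by omega)]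
        have ne : ∀ q : ℕ, q < n + 1 → f (p + ((q + 1 : ℕ) : Fin (n + 2))) ≠ w := by
          intro q hq h
          have := f.injective (h.trans hp.symm)
          have h0 : ((q + 1 : ℕ) : Fin (n + 2)) = 0 := by simpa using this
          rw [Fin.natCast_eq_zero] at h0
          exact absurd (Nat.le_of_dvd (by omega) h0) (by omega)
        have e : p + ((m + 1 + 1 : ℕ) : Fin (n + 2)) = p + ((m + 1 : ℕ) : Fin (n + 2)) + 1 := by
          push_cast; abel
        have h1 := ne m (by omega)
        have h2 := ne (m + 1) hm
        rw [e] at h2 ⊢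
        exact (step _ h1 h2).symm
    have all : ∀ a, a ≠ p → (f a ∈ S ↔ f (p + 1) ∈ S) := by
      intro a ha
      have hpos : (a - p).val ≠ 0 := by
        intro h
        exact ha (sub_eq_zero.1 (Fin.ext h))
      obtain ⟨m, hm⟩ := Nat.exists_eq_succ_of_ne_zero hpos
      have hlt := (a - p).isLt
      have := main m (by omega)
      have e := cast_sub p a
      rw [hm] at e
      rwa [e] at this
    by_cases hj : j = p
    · right; rw [hj, hp]
    · left
      have hip : i ≠ p := by
        rintro rfl
        exact hw (hp ▸ hi)
      exact (all j hj).2 ((all i hip).1 hi)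
  · push Not at hp
    left
    have main : ∀ m : ℕ, f (i + (m : Fin (n + 2))) ∈ S := by
      intro m
      induction m with
      | zero => simpa using hi
      | succ m ih =>
        have e : i + ((m + 1 : ℕ) : Fin (n + 2)) = i + (m : Fin (n + 2)) + 1 := by
          push_cast; abel
        rw [e]
        exact (step _ (hp _) (hp _)).1 ih
    simpa [cast_sub] using main (j - i).val

/-- Two vertices at distance two have a common neighbour. -/
theorem exists_adj_adj_of_dist_eq_two {V : Type*} {G : SimpleGraph V} {u v : V} (h : G.dist u v = 2) :
    ∃ m, G.Adj u m ∧ G.Adj m v := by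
  have hr : G.Reachable u v := by
    by_contra hr
    simp [SimpleGraph.dist_eq_zero_of_not_reachable hr] at h
  obtain ⟨p, hp⟩ := hr.exists_walk_length_eq_dist
  rw [h] at hp
  match p, hp with
  | .cons h1 (.cons h2 .nil), _ => exact ⟨_, h1, h2⟩

theorem dist_eq_two_of_adj_adj {V : Type*} {G : SimpleGraph V} {u v m : V} (h1 : G.Adj u m) (h2 : G.Adj m v)
    (hne : u ≠ v) (hadj : ¬ G.Adj u v) : G.dist u v = 2 := by
  have hle := SimpleGraph.dist_le (SimpleGraph.Walk.cons h1 (.cons h2 .nil))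
  simp only [SimpleGraph.Walk.length_cons, SimpleGraph.Walk.length_nil] at hle
  have h0 := (h1.reachable.trans h2.reachable).pos_dist_of_ne hne
  have hn : G.dist u v ≠ 1 := fun h => hadj (SimpleGraph.dist_eq_one_iff_adj.1 h)
  omega

end SimpleGraph

theorem IsSpanningTreeOf.dist_le {V : Type*} {T G : SimpleGraph V} (h : IsSpanningTreeOf T G)
    (u v : V) : G.dist u v ≤ T.dist u v := by
  obtain ⟨p, hp⟩ := (h.2.connected u v).exists_walk_length_eq_dist
  rw [← hp, ← SimpleGraph.Walk.length_mapLe h.1 p]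
  exact SimpleGraph.dist_le _

/-! ### FC trees of `G_k` -/

namespace ChordalGadgetVertex

variable {k : ℕ}

theorem r_adj {v : ChordalGadgetVertex k} : (chordalGadget k).graph.Adj r v ↔ ∃ i, v = node i := by
  rcases v with _ | i | _ | i <;> simp [chordalGadget, SimpleGraph.fromRel_adj, edge]

theorem ear_adj {i : Fin (k + 1)} {v : ChordalGadgetVertex k} :
    (chordalGadget k).graph.Adj (ear i) v ↔ v = t₀ ∨ v = node i := by
  rcases v with _ | i | _ | i <;> simp [chordalGadget, SimpleGraph.fromRel_adj, edge, eq_comm]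

theorem t₀_adj {v : ChordalGadgetVertex k} :
    (chordalGadget k).graph.Adj t₀ v ↔ (∃ i, v = node i) ∨ ∃ i, v = ear i := by
  rcases v with _ | i | _ | i <;> simp [chordalGadget, SimpleGraph.fromRel_adj, edge]

theorem node_adj_node {i j : Fin (k + 1)} :
    (chordalGadget k).graph.Adj (node i) (node j) ↔ i ≠ j := by
  simp [chordalGadget, SimpleGraph.fromRel_adj, edge]

/-- The only common neighbour of `r` and `ear i` is `node i`, so an FC tree contains all paths `r,
node i, ear i`. It reaches `t₀` through a single `node j`. For `i ≠ j` its path from `t₀` to `ear i`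
goes through `r` and has length 4, while the two vertices are adjacent in `G_k`. -/
theorem exists_unspanned {T : SimpleGraph (ChordalGadgetVertex k)}
    (hT : (chordalGadget k).IsFCTree T) : ∃ j, ∀ i, i ≠ j →
      (chordalGadget k).graph.dist t₀ (ear i) + 2 < T.dist t₀ (ear i) := by
  obtain ⟨⟨hle, htree⟩, hfc⟩ := hT
  have hear : ∀ i, T.Adj r (node i) ∧ T.Adj (node i) (ear i) := by
    intro i
    have h : T.dist r (ear i) = 2 := by
      refine (hfc _ (Or.inr ⟨i, rfl⟩)).trans
        (SimpleGraph.dist_eq_two_of_adj_adj (r_adj.2 ⟨i, rfl⟩) (ear_adj.2 (Or.inr rfl)).symm (by simp [chordalGadget]) ?_)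
      rw [show (chordalGadget k).root = r from rfl, r_adj]
      simp
    obtain ⟨m, h1, h2⟩ := SimpleGraph.exists_adj_adj_of_dist_eq_two h
    obtain ⟨i', rfl⟩ := r_adj.1 (hle h1)
    have h3 := ear_adj.1 (hle h2).symm
    simp only [reduceCtorEq, node.injEq, false_or] at h3
    subst h3
    exact ⟨h1, h2⟩
  have ht : T.dist r t₀ = 2 := by
    refine (hfc _ (Or.inl rfl)).trans
      (SimpleGraph.dist_eq_two_of_adj_adj (r_adj.2 ⟨0, rfl⟩) (t₀_adj.2 (Or.inl ⟨0, rfl⟩)).symm (by simp [chordalGadget]) ?_)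
    rw [show (chordalGadget k).root = r from rfl, r_adj]
    simp
  obtain ⟨m, h1, h2⟩ := SimpleGraph.exists_adj_adj_of_dist_eq_two ht
  obtain ⟨j, rfl⟩ := r_adj.1 (hle h1)
  refine ⟨j, fun i hij => ?_⟩
  have hG : (chordalGadget k).graph.dist t₀ (ear i) = 1 :=
    SimpleGraph.dist_eq_one_iff_adj.2 (t₀_adj.2 (Or.inr ⟨i, rfl⟩))
  let p : T.Walk t₀ (ear i) :=
    .cons h2.symm (.cons h1.symm (.cons (hear i).1 (.cons (hear i).2 .nil)))
  have hp : p.IsPath := by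
    simp [p, SimpleGraph.Walk.isPath_def, hij.symm]
  obtain ⟨q, hq, hqlen⟩ := (htree.connected t₀ (ear i)).exists_path_of_dist
  have := (htree.isAcyclic.subsingleton_path t₀ (ear i)).elim ⟨p, hp⟩ ⟨q, hq⟩
  have hpq : p = q := congrArg Subtype.val this
  rw [hG, ← hqlen, ← hpq]
  simp [p]

end ChordalGadgetVertex

-- Pigeonhole: each of the at most `k` trees excludes one index `j`, and there are `k + 1` indices.
open ChordalGadgetVertex in
theorem isDGadget_chordalGadget (k : ℕ) : (chordalGadget k).IsDGadget 2 k := by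
  classical
  intro 𝒯 hcard hfc
  choose! j hj using fun T hT => exists_unspanned (hfc T hT)
  obtain ⟨i, hi⟩ : ∃ i, i ∉ 𝒯.image j := by
    by_contra! h
    have h1 := Finset.card_le_card (fun i _ => h i : Finset.univ ⊆ 𝒯.image j)
    have h2 := Finset.card_image_le (s := 𝒯) (f := j)
    simp only [Finset.card_univ, Fintype.card_fin] at h1
    omega
  refine ⟨t₀, Or.inl rfl, ear i, Or.inr ⟨i, rfl⟩, by simp, fun T hT => hj T hT i ?_⟩
  rintro rfl
  exact hi (Finset.mem_image_of_mem j hT)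

/-! ### Copies of the gadget: projections, restrictions of trees, cut vertices -/

namespace RootedGadget

variable {V : Type*} (Γ : RootedGadget V)

open Classical in
/-- The vertex of the copy `l` through which the copy `l'` is attached to it. -/
noncomputable def gate (l : List Γ.terminals) : List Γ.terminals → V
  | [] => Γ.root
  | t :: l' => if l' = l then t else gate l l'

open Classical in
/-- The retraction of the tree of gadgets onto the copy `l`. -/
noncomputable def proj {D : ℕ} (l : Γ.Address D) : Γ.TreeVertex D → V
  | none => Γ.root
  | some (l', v) => if l'.1 = l.1 then v else Γ.gate l.1 l'.1

variable {D : ℕ}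

theorem gate_eq_root (l l' : List Γ.terminals) (h : l'.length ≤ l.length) :
    Γ.gate l l' = Γ.root := by
  induction l' with
  | nil => rfl
  | cons t l' ih =>
    simp only [List.length_cons] at h
    have hne : l' ≠ l := by
      rintro rfl
      omega
    rw [gate, if_neg hne, ih (by omega)]

theorem proj_copyRoot (l l' : Γ.Address D) : Γ.proj l (Γ.copyRoot l') = Γ.gate l.1 l'.1 := by
  obtain ⟨l', hl'⟩ := l'
  cases l' with
  | nil => rfl
  | cons t l' => rfl

theorem copyVertex_root (l : Γ.Address D) : Γ.copyVertex l Γ.root = Γ.copyRoot l := by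
  simp [copyVertex]

theorem copyVertex_of_ne (l : Γ.Address D) {a : V} (h : a ≠ Γ.root) :
    Γ.copyVertex l a = some (l, ⟨a, h⟩) := by
  simp [copyVertex, h]

theorem copyVertex_terminal (l : List Γ.terminals) (t : Γ.terminals) (h : (t :: l).length < D)
    (h' : l.length < D) : Γ.copyVertex ⟨l, h'⟩ t.1 = Γ.copyRoot ⟨t :: l, h⟩ := by
  have ht : t.1 ≠ Γ.root := fun e => Γ.root_notMem (e ▸ t.2)
  rw [copyVertex_of_ne _ _ ht]
  rfl

theorem proj_copyVertex_self (l : Γ.Address D) (a : V) : Γ.proj l (Γ.copyVertex l a) = a := by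
  by_cases h : a = Γ.root
  · rw [h, copyVertex_root, proj_copyRoot, gate_eq_root _ _ _ le_rfl]
  · simp [copyVertex_of_ne _ _ h, proj]

theorem proj_copyVertex_of_ne {l l' : Γ.Address D} (hl : l' ≠ l) (a : V) :
    Γ.proj l (Γ.copyVertex l' a) = Γ.gate l.1 l'.1 := by
  by_cases h : a = Γ.root
  · rw [h, copyVertex_root, proj_copyRoot]
  · simp [copyVertex_of_ne _ _ h, proj, Subtype.ext_iff.not.1 hl]

/-- Edges of subgraphs of the tree of gadgets project to edges of their restrictions to a copy. -/
theorem proj_adj {T : SimpleGraph (Γ.TreeVertex D)} (hT : T ≤ Γ.treeOfGadgets D)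
    (l : Γ.Address D) (x y : Γ.TreeVertex D) (h : T.Adj x y) :
    Γ.proj l x = Γ.proj l y ∨ (T.comap (Γ.copyVertex l)).Adj (Γ.proj l x) (Γ.proj l y) := by
  obtain ⟨l', a, b, -, rfl, rfl⟩ := hT h
  by_cases hl : l' = l
  · subst hl
    right
    simpa [proj_copyVertex_self] using h
  · left
    rw [proj_copyVertex_of_ne _ hl, proj_copyVertex_of_ne _ hl]

/-- An edge coming from a different copy would have both ends collapsed to one vertex by `proj l`,
so it cannot join two distinct vertices of the copy `l`. -/
theorem treeOfGadgets_adj_copyVertex (l : Γ.Address D) {a b : V} :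
    (Γ.treeOfGadgets D).Adj (Γ.copyVertex l a) (Γ.copyVertex l b) ↔ Γ.graph.Adj a b := by
  refine ⟨fun hadj => ?_, fun h => ⟨l, a, b, h, rfl, rfl⟩⟩
  have hne := hadj.ne
  obtain ⟨l', a', b', h, ha, hb⟩ := hadj
  have ha' := congrArg (Γ.proj l) ha
  have hb' := congrArg (Γ.proj l) hb
  rw [proj_copyVertex_self] at ha' hb'
  by_cases hl : l' = l
  · subst hl
    rw [proj_copyVertex_self] at ha' hb'
    rwa [ha', hb']
  · rw [proj_copyVertex_of_ne _ hl] at ha' hb'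
    exact absurd (congrArg (Γ.copyVertex l) (ha'.trans hb'.symm)) hne

/-- A copy of the gadget, as an induced subgraph of the tree of gadgets. -/
noncomputable def copyEmbedding (l : Γ.Address D) : Γ.graph ↪g Γ.treeOfGadgets D where
  toFun := Γ.copyVertex l
  inj' := Γ.copyVertex_injective l
  map_rel_iff' := Γ.treeOfGadgets_adj_copyVertex l

theorem dist_copyVertex_le (l : Γ.Address D) (a b : V) :
    (Γ.treeOfGadgets D).dist (Γ.copyVertex l a) (Γ.copyVertex l b) ≤ Γ.graph.dist a b := by
  obtain ⟨p, hp⟩ := (Γ.connected a b).exists_walk_length_eq_dist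
  rw [← hp, ← SimpleGraph.Walk.length_map (Γ.copyEmbedding l).toHom p]
  exact SimpleGraph.dist_le _

theorem treeOfGadgets_connected (D : ℕ) : (Γ.treeOfGadgets D).Connected := by
  have hcopy : ∀ (l : Γ.Address D) (a : V),
      (Γ.treeOfGadgets D).Reachable (Γ.copyVertex l a) (Γ.copyRoot l) := by
    intro l a
    rw [← copyVertex_root]
    exact (Γ.connected a Γ.root).map (Γ.copyEmbedding l).toHom
  have hroot : ∀ (l : List Γ.terminals) (hl : l.length < D),
      (Γ.treeOfGadgets D).Reachable (Γ.copyRoot ⟨l, hl⟩) none := by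
    intro l
    induction l with
    | nil => exact fun _ => SimpleGraph.Reachable.refl _
    | cons t l ih =>
      intro hl
      have hl' : l.length < D := lt_trans (Nat.lt_succ_self _) hl
      rw [← copyVertex_terminal Γ l t hl hl']
      exact (hcopy _ _).trans (ih hl')
  have h : ∀ x, (Γ.treeOfGadgets D).Reachable x none := by
    rintro (_ | ⟨l, a⟩)
    · exact SimpleGraph.Reachable.refl _
    · have := (hcopy l a.1).trans (hroot l.1 l.2)
      rwa [copyVertex_of_ne _ _ a.2] at this
  exact { preconnected := fun u v => (h u).trans (h v).symm, nonempty := ⟨none⟩ }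

instance finite_treeVertex (D : ℕ) : Finite (Γ.TreeVertex D) := by
  have := Γ.finite
  have : Finite (Γ.Address D) := (List.finite_length_lt Γ.terminals D).to_subtype
  infer_instance

/-- The restriction of a spanning tree of the tree of gadgets to a copy is a spanning tree. -/
theorem isSpanningTreeOf_comap {T : SimpleGraph (Γ.TreeVertex D)}
    (hT : IsSpanningTreeOf T (Γ.treeOfGadgets D)) (l : Γ.Address D) :
    IsSpanningTreeOf (T.comap (Γ.copyVertex l)) Γ.graph := by
  refine ⟨fun a b h => (Γ.treeOfGadgets_adj_copyVertex l).1 (hT.1 h), ?_, ?_⟩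
  · refine { preconnected := fun a b => ?_, nonempty := ⟨Γ.root⟩ }
    obtain ⟨p⟩ := hT.2.connected (Γ.copyVertex l a) (Γ.copyVertex l b)
    -- A walk of `T` may leave the copy; its projection stays inside.
    obtain ⟨q, -⟩ := p.exists_length_le_of_adj_imp (Γ.proj_adj hT.1 l)
    rw [proj_copyVertex_self, proj_copyVertex_self] at q
    exact ⟨q⟩
  · exact hT.2.isAcyclic.comap ⟨Γ.copyVertex l, fun h => h⟩ (Γ.copyVertex_injective l)

theorem dist_comap_le {T : SimpleGraph (Γ.TreeVertex D)}
    (hT : IsSpanningTreeOf T (Γ.treeOfGadgets D)) (l : Γ.Address D) (a b : V) :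
    (T.comap (Γ.copyVertex l)).dist a b ≤ T.dist (Γ.copyVertex l a) (Γ.copyVertex l b) := by
  obtain ⟨p, hp⟩ :=
    (hT.2.connected (Γ.copyVertex l a) (Γ.copyVertex l b)).exists_walk_length_eq_dist
  obtain ⟨q, hq⟩ := p.exists_length_le_of_adj_imp (Γ.proj_adj hT.1 l)
  rw [← hp]
  have := (SimpleGraph.dist_le q).trans hq
  rwa [proj_copyVertex_self, proj_copyVertex_self] at this

/-- The vertices strictly below the root of the copy `l`. -/
def below (l : Γ.Address D) : Set (Γ.TreeVertex D) :=
  {x | ∃ l' v, x = some (l', v) ∧ l.1 <:+ l'.1}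

theorem some_mem_below {l l' : Γ.Address D} {v : {v : V // v ≠ Γ.root}} :
    (some (l', v) : Γ.TreeVertex D) ∈ Γ.below l ↔ l.1 <:+ l'.1 := by
  constructor
  · rintro ⟨l'', v', h, hl⟩
    simp only [Option.some.injEq, Prod.mk.injEq] at h
    rwa [h.1]
  · exact fun h => ⟨l', v, rfl, h⟩

theorem copyRoot_mem_below {l l' : Γ.Address D} :
    Γ.copyRoot l' ∈ Γ.below l ↔ l.1 <:+ l'.1 ∧ l' ≠ l := by
  obtain ⟨l', hl'⟩ := l'
  obtain ⟨l, hl⟩ := l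
  cases l' with
  | nil =>
    simp only [below, copyRoot, Set.mem_ofPred_eq, reduceCtorEq, false_and, exists_false,
      List.suffix_nil, ne_eq, Subtype.mk.injEq, false_iff, not_and, not_not]
    exact fun h => h.symm
  | cons t l' =>
    simp only [copyRoot, some_mem_below, List.suffix_cons_iff, ne_eq, Subtype.mk.injEq]
    constructor
    · intro h
      refine ⟨Or.inr h, ?_⟩
      rintro rfl
      have := h.length_le
      simp at this
    · rintro ⟨h | h, hne⟩
      · exact absurd h.symm hne
      · exact h

/-- The cut-vertex property, used both for distances in trees and for chordality. -/
theorem eq_copyRoot_of_adj {l : Γ.Address D} {x y : Γ.TreeVertex D}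
    (h : (Γ.treeOfGadgets D).Adj x y) (hx : x ∈ Γ.below l) (hy : y ∉ Γ.below l) :
    y = Γ.copyRoot l := by
  obtain ⟨l', a, b, -, rfl, rfl⟩ := h
  have hl : l.1 <:+ l'.1 := by
    by_cases ha : a = Γ.root
    · rw [ha, copyVertex_root, copyRoot_mem_below] at hx
      exact hx.1
    · rwa [copyVertex_of_ne _ _ ha, some_mem_below] at hx
  by_cases hb : b = Γ.root
  · rw [hb, copyVertex_root] at hy ⊢
    rw [copyRoot_mem_below] at hy
    by_contra hne
    exact hy ⟨hl, fun e => hne (by rw [e])⟩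
  · rw [copyVertex_of_ne _ _ hb, some_mem_below] at hy
    exact absurd hl hy

theorem dist_add_dist_le {T : SimpleGraph (Γ.TreeVertex D)}
    (hT : IsSpanningTreeOf T (Γ.treeOfGadgets D)) {l l' : Γ.Address D} (hl : l.1 <:+ l'.1)
    {v : Γ.TreeVertex D} (hv : v ∉ Γ.below l) :
    T.dist (Γ.copyRoot l') (Γ.copyRoot l) + T.dist (Γ.copyRoot l) v ≤
      T.dist (Γ.copyRoot l') v := by
  by_cases h : l' = l
  · subst h
    simp
  · exact SimpleGraph.dist_add_dist_le_of_cut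
      (fun x y hxy => Γ.eq_copyRoot_of_adj (hT.1 hxy)) (hT.2.connected _ _)
      (Γ.copyRoot_mem_below.2 ⟨hl, h⟩) hv

/-! ### Chordality -/

/-- Trees of gadgets of chordal gadgets are chordal. -/
theorem isChordalGraph_treeOfGadgets (h : IsChordalGraph Γ.graph) (D : ℕ) :
    IsChordalGraph (Γ.treeOfGadgets D) := by
  intro n hn
  refine ⟨fun f => ?_⟩
  obtain ⟨m, rfl⟩ := Nat.exists_eq_add_of_le' (show 2 ≤ n by omega)
  let depth : Γ.TreeVertex D → ℕ := fun x => x.elim 0 fun y => y.1.1.length + 1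
  -- The cut at the root of the copy `l` containing a deepest vertex keeps the cycle at or below
  -- that root, and maximality of the depth then confines it to the copy `l`.
  obtain ⟨i, hi⟩ := Finite.exists_max fun j => depth (f j)
  rcases hfi : f i with _ | ⟨l, v⟩
  · have all : ∀ j, f j = none := by
      intro j
      have := hi j
      rcases hj : f j with _ | y
      · rfl
      · simp [depth, hfi, hj] at this
    exact absurd (f.injective ((all 0).trans (all 1).symm)) (by simp)
  · have hrange : ∀ j, ∃ a, Γ.copyVertex l a = f j := by
      intro j
      have hroot : Γ.copyRoot l ∉ Γ.below l := by simp [copyRoot_mem_below]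
      have := f.cycleGraph_mem_or_eq_of_cut hroot (fun x y => Γ.eq_copyRoot_of_adj)
        (i := i) (by rw [hfi, some_mem_below]) j
      rcases this with ⟨l', w, hj, hl⟩ | hj
      · have hd := hi j
        simp only [depth, hfi, hj, Option.elim_some, add_le_add_iff_right] at hd
        have hll : l' = l := Subtype.ext (hl.eq_of_length_le hd).symm
        exact ⟨w.1, by rw [hj, hll, copyVertex_of_ne _ _ w.2]⟩
      · exact ⟨Γ.root, by rw [hj, copyVertex_root]⟩
    choose g hg using hrange
    refine (h _ hn).false ⟨⟨g, fun a b hab => f.injective ?_⟩, ?_⟩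
    · rw [← hg, ← hg, hab]
    · intro a b
      change Γ.graph.Adj (g a) (g b) ↔ _
      rw [← Γ.treeOfGadgets_adj_copyVertex l, hg, hg, f.map_adj_iff]

end RootedGadget

-- The neighbourhoods of `r` and of each `ear i` are cliques, so an induced cycle avoids these
-- vertices. The remaining vertices, `t₀` and the nodes, form a clique.
open ChordalGadgetVertex in
theorem isChordalGraph_chordalGadget (k : ℕ) : IsChordalGraph (chordalGadget k).graph := by
  intro n hn
  refine ⟨fun f => ?_⟩
  have hclique : ∀ j, f j = t₀ ∨ ∃ i, f j = node i := by
    intro j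
    obtain ⟨a, b, ha, hb, hne, hab⟩ := f.exists_neighbors_of_cycleGraph hn j
    rcases hj : f j with _ | i | _ | i
    · rw [hj, r_adj] at ha hb
      obtain ⟨i, hi⟩ := ha
      obtain ⟨i', hi'⟩ := hb
      rw [hi, hi', node_adj_node] at hab
      rw [hi, hi'] at hne
      exact absurd (fun e => hne (congrArg _ e)) hab
    · exact Or.inr ⟨i, rfl⟩
    · exact Or.inl rfl
    · rw [hj, ear_adj] at ha hb
      exfalso
      rcases ha with ha | ha <;> rcases hb with hb | hb <;> rw [ha, hb] at hne hab
      · exact hne rfl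
      · exact hab (t₀_adj.2 (Or.inl ⟨i, rfl⟩))
      · exact hab (t₀_adj.2 (Or.inl ⟨i, rfl⟩)).symm
      · exact hne rfl
  obtain ⟨a, b, -, -, hne, hab⟩ := f.exists_neighbors_of_cycleGraph hn ⟨0, by omega⟩
  rcases hclique a with ha | ⟨i, ha⟩ <;> rcases hclique b with hb | ⟨i', hb⟩ <;>
    rw [ha, hb] at hne hab
  · exact hne rfl
  · exact hab (t₀_adj.2 (Or.inl ⟨i', rfl⟩))
  · exact hab (t₀_adj.2 (Or.inl ⟨i, rfl⟩)).symm
  · exact hab (node_adj_node.2 fun e => hne (congrArg _ e))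

/-! ### Accumulating losses along a descent -/

namespace RootedGadget

variable {V : Type*} (Γ : RootedGadget V) {D : ℕ}

/-- If every tree of `ℬ` fails to be fast connecting somewhere in the `N` levels below every copy
that is below `l`, then a descent of bounded depth makes each tree lose as often as prescribed. -/
theorem exists_descent {𝒯 : Finset (SimpleGraph (Γ.TreeVertex D))}
    (h𝒯 : ∀ T ∈ 𝒯, IsSpanningTreeOf T (Γ.treeOfGadgets D)) {N E : ℕ} (hE : E ≤ D)
    (l : Γ.Address D) (q : Multiset (SimpleGraph (Γ.TreeVertex D)))
    (hq : ∀ T ∈ q, T ∈ 𝒯 ∧ ∀ l' : Γ.Address D, l.1 <:+ l'.1 → l'.1.length + N ≤ E →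
      ∃ l'' : Γ.Address D, l'.1 <:+ l''.1 ∧ l''.1.length < l'.1.length + N ∧
        ¬ Γ.IsFCTree (T.comap (Γ.copyVertex l'')))
    [DecidableEq (SimpleGraph (Γ.TreeVertex D))]
    (hlen : l.1.length + q.card * N < E) :
    ∃ l' : Γ.Address D, l.1 <:+ l'.1 ∧ l'.1.length ≤ l.1.length + q.card * N ∧ ∀ T ∈ 𝒯,
      (Γ.treeOfGadgets D).dist (Γ.copyRoot l') (Γ.copyRoot l) + q.count T ≤
        T.dist (Γ.copyRoot l') (Γ.copyRoot l) := by
  induction q using Multiset.induction with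
  | empty => exact ⟨l, List.suffix_rfl, by simp, by simp⟩
  | cons T₀ q ih =>
    rw [Multiset.card_cons, add_mul, one_mul] at hlen
    obtain ⟨l₁, hl₁, hlen₁, hgap⟩ :=
      ih (fun T hT => hq T (Multiset.mem_cons_of_mem hT)) (by omega)
    obtain ⟨hT₀, hloss⟩ := hq T₀ (Multiset.mem_cons_self _ _)
    obtain ⟨l₂, hl₂, hlen₂, hfc⟩ := hloss l₁ hl₁ (by omega)
    -- Tree distances are never shorter, so a difference means a loss of at least 1 for `T₀`. The
    -- descent continues in the copy glued at `t`.
    obtain ⟨t, ht, hdist⟩ : ∃ t ∈ Γ.terminals,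
        (T₀.comap (Γ.copyVertex l₂)).dist Γ.root t ≠ Γ.graph.dist Γ.root t := by
      by_contra! h
      exact hfc ⟨Γ.isSpanningTreeOf_comap (h𝒯 _ hT₀) l₂, h⟩
    have hl₃ : (⟨t, ht⟩ :: l₂.1 : List Γ.terminals).length < D := by
      simp only [List.length_cons]
      omega
    have hroot := Γ.copyVertex_terminal l₂.1 ⟨t, ht⟩ hl₃ l₂.2
    have hsuff : l₂.1 <:+ ⟨t, ht⟩ :: l₂.1 := List.suffix_cons _ _
    have hconn := Γ.treeOfGadgets_connected D
    refine ⟨⟨⟨t, ht⟩ :: l₂.1, hl₃⟩, hl₁.trans (hl₂.trans hsuff), ?_, fun T hT => ?_⟩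
    · simp only [List.length_cons, Multiset.card_cons, add_mul, one_mul]
      omega
    · have hs := h𝒯 T hT
      have not_below : ∀ {a b : Γ.Address D}, a.1 <:+ b.1 → Γ.copyRoot a ∉ Γ.below b := by
        intro a b hab h
        rw [copyRoot_mem_below] at h
        exact h.2 (Subtype.ext (hab.eq_of_length_le h.1.length_le))
      have d1 := Γ.dist_add_dist_le hs (l' := ⟨_, hl₃⟩) (l := l₂) hsuff
        (not_below (hl₁.trans hl₂))
      have d2 := Γ.dist_add_dist_le hs hl₂ (not_below hl₁)
      have e1 := hconn.dist_triangle (u := Γ.copyRoot ⟨_, hl₃⟩) (v := Γ.copyRoot l₂)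
        (w := Γ.copyRoot l)
      have e2 := hconn.dist_triangle (u := Γ.copyRoot l₂) (v := Γ.copyRoot l₁)
        (w := Γ.copyRoot l)
      have m1 := hs.dist_le (Γ.copyRoot ⟨_, hl₃⟩) (Γ.copyRoot l₂)
      have m2 := hs.dist_le (Γ.copyRoot l₂) (Γ.copyRoot l₁)
      have m3 := hgap T hT
      rw [Multiset.count_cons]
      split_ifs with hTT
      · subst hTT
        have s1 := Γ.dist_copyVertex_le l₂ t Γ.root
        have s2 := Γ.dist_comap_le hs l₂ t Γ.root
        have s3 := (Γ.isSpanningTreeOf_comap hs l₂).dist_le t Γ.root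
        rw [copyVertex_root, hroot] at s1 s2
        rw [SimpleGraph.dist_comm, SimpleGraph.dist_comm (G := Γ.graph)] at hdist
        omega
      · omega

/-- The bound on the depth that is needed when fewer than `b` trees are not known to be fast
connecting. -/
def depthBound (c : ℕ) : ℕ → ℕ
  | 0 => 0
  | b + 1 => 2 + (c + 1) * b * depthBound c b

/-- Induction on a strict bound `b` for the number of trees outside `𝒜`; the levels from `l` up to
`E` form the window in which all trees of `𝒜` are FC. -/
theorem exists_unspanned_pair {c d : ℕ} (hΓ : Γ.IsDGadget c d)
    {𝒯 : Finset (SimpleGraph (Γ.TreeVertex D))} (hcard : 𝒯.card ≤ d)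
    (h𝒯 : ∀ T ∈ 𝒯, IsSpanningTreeOf T (Γ.treeOfGadgets D))
    [DecidableEq (SimpleGraph (Γ.TreeVertex D))] (b : ℕ) :
    ∀ (𝒜 : Finset (SimpleGraph (Γ.TreeVertex D))) (l : Γ.Address D) (E : ℕ), 𝒜 ⊆ 𝒯 →
      (𝒯 \ 𝒜).card < b → E ≤ D → l.1.length + depthBound c b ≤ E →
      (∀ T ∈ 𝒜, ∀ l' : Γ.Address D, l.1 <:+ l'.1 → l'.1.length < E →
        Γ.IsFCTree (T.comap (Γ.copyVertex l'))) →
      ∃ u v, ∀ T ∈ 𝒯, (Γ.treeOfGadgets D).dist u v + c < T.dist u v := by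
  classical
  induction b with
  | zero => intro _ _ _ _ h; omega
  | succ b ih =>
    intro 𝒜 l E h𝒜 hb hE hlen hfc
    -- At most `b` trees must each lose `c + 1` times, at a cost of `depthBound c b` levels per
    -- loss. The extra 2 pays for the step from `l` to its child at `s` and for the strict
    -- inequality in `exists_descent`.
    rw [depthBound] at hlen
    obtain ⟨s, hs, t, ht, -, hst⟩ := hΓ (𝒜.image fun T => T.comap (Γ.copyVertex l))
      (Finset.card_image_le.trans ((Finset.card_le_card h𝒜).trans hcard)) (by
        simp only [Finset.mem_image, forall_exists_index, and_imp, forall_apply_eq_imp_iff₂]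
        exact fun T hT => hfc T hT l List.suffix_rfl (by omega))
    simp only [Finset.mem_image, forall_exists_index, and_imp, forall_apply_eq_imp_iff₂] at hst
    have hl : ∀ x : Γ.terminals, (x :: l.1).length < D := by
      intro x
      simp only [List.length_cons]
      omega
    let ls : Γ.Address D := ⟨⟨s, hs⟩ :: l.1, hl _⟩
    by_cases hloss : ∀ T ∈ 𝒯 \ 𝒜, ∀ l' : Γ.Address D, ls.1 <:+ l'.1 →
        l'.1.length + depthBound c b ≤ E →
        ∃ l'' : Γ.Address D, l'.1 <:+ l''.1 ∧ l''.1.length < l'.1.length + depthBound c b ∧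
          ¬ Γ.IsFCTree (T.comap (Γ.copyVertex l''))
    · have hmem : ∀ T ∈ (c + 1) • (𝒯 \ 𝒜).val, T ∈ 𝒯 \ 𝒜 :=
        fun T hT => Multiset.mem_of_mem_nsmul hT
      obtain ⟨l', hl', -, hgap⟩ := Γ.exists_descent h𝒯 hE ls ((c + 1) • (𝒯 \ 𝒜).val)
        (fun T hT => ⟨(Finset.mem_sdiff.1 (hmem T hT)).1, hloss T (hmem T hT)⟩) (by
          have h1 : (c + 1) * (𝒯 \ 𝒜).card * depthBound c b ≤ (c + 1) * b * depthBound c b := by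
            gcongr
            omega
          simp only [ls, List.length_cons, Multiset.card_nsmul, Finset.card_val]
          omega)
      -- Every route between these vertices passes through `s`: trees of `𝒜` lose more than `c`
      -- between `s` and `t`, the others below `s`.
      refine ⟨Γ.copyRoot l', Γ.copyVertex l t, fun T hT => ?_⟩
      have hsp := h𝒯 T hT
      have hbelow : Γ.copyVertex l t ∉ Γ.below ls := by
        rw [Γ.copyVertex_of_ne l fun e => Γ.root_notMem (e ▸ ht), some_mem_below]
        intro h
        have := h.length_le
        simp [ls] at this
      have d1 := Γ.dist_add_dist_le hsp hl' hbelow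
      have e1 := (Γ.treeOfGadgets_connected D).dist_triangle (u := Γ.copyRoot l')
        (v := Γ.copyRoot ls) (w := Γ.copyVertex l t)
      have m1 := hsp.dist_le (Γ.copyRoot ls) (Γ.copyVertex l t)
      have m2 := hgap T hT
      by_cases hTA : T ∈ 𝒜
      · have s1 := Γ.dist_copyVertex_le l s t
        have s2 := Γ.dist_comap_le hsp l s t
        have s3 := hst T hTA
        have hroot : Γ.copyVertex l s = Γ.copyRoot ls :=
          Γ.copyVertex_terminal l.1 ⟨s, hs⟩ (hl _) l.2
        rw [hroot] at s1 s2
        omega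
      · have : ((c + 1) • (𝒯 \ 𝒜).val).count T = c + 1 := by
          rw [Multiset.count_nsmul, Multiset.count_eq_one_of_mem (𝒯 \ 𝒜).nodup
            (Finset.mem_def.1 (Finset.mem_sdiff.2 ⟨hT, hTA⟩)), mul_one]
        omega
    · push Not at hloss
      obtain ⟨T, hT, l', hl', hlen', hall⟩ := hloss
      obtain ⟨hT𝒯, hT𝒜⟩ := Finset.mem_sdiff.1 hT
      -- `T` is FC throughout the next `depthBound c b` levels below `l'`, which become the new
      -- window.
      refine ih (insert T 𝒜) l' (l'.1.length + depthBound c b)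
        (Finset.insert_subset hT𝒯 h𝒜) ?_ (by omega) le_rfl ?_
      · rw [Finset.sdiff_insert]
        have := Finset.card_erase_lt_of_mem hT
        omega
      · intro T' hT' l'' hl'' hlen''
        rcases Finset.mem_insert.1 hT' with rfl | hT'
        · exact hall l'' hl'' hlen''
        · exact hfc T' hT' l'' (((List.suffix_cons _ _).trans hl').trans hl'') (by omega)

/-- Deep trees of `d`-gadgets are not collectively spanned by `d` trees. -/
theorem not_admitsCollectiveTreeSpanners_treeOfGadgets {c d : ℕ} (hΓ : Γ.IsDGadget c d)
    (hD : depthBound c (d + 1) ≤ D) : ¬ AdmitsCollectiveTreeSpanners (Γ.treeOfGadgets D) d c := by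
  classical
  rintro ⟨𝒯, hcard, h𝒯, hspan⟩
  have hpos : 0 < D := by
    rw [depthBound] at hD
    omega
  obtain ⟨u, v, huv⟩ := Γ.exists_unspanned_pair hΓ hcard h𝒯 (d + 1) ∅ ⟨[], hpos⟩ D
    (Finset.empty_subset _) (by simpa using Nat.lt_succ_of_le hcard) le_rfl (by simpa using hD)
    (by simp)
  obtain ⟨T, hT, hle⟩ := hspan u v
  have := huv T hT
  omega

end RootedGadget

theorem mainTheorem4 (k : ℕ) :
    (∃ (V : Type) (_ : Finite V) (G : SimpleGraph V),
      G.Connected ∧ IsChordalGraph G ∧ ¬ AdmitsCollectiveTreeSpanners G k 2) ∧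
    IsChordalGraph (chordalGadget k).graph ∧
    (chordalGadget k).IsDGadget 2 k ∧
    (∃ D₀ : ℕ, ∀ D : ℕ, D₀ ≤ D →
      ((chordalGadget k).treeOfGadgets D).Connected ∧
      IsChordalGraph ((chordalGadget k).treeOfGadgets D) ∧
      ¬ AdmitsCollectiveTreeSpanners ((chordalGadget k).treeOfGadgets D) k 2) := by
  have hch := isChordalGraph_chordalGadget k
  have hgad := isDGadget_chordalGadget k
  have main : ∀ D : ℕ, RootedGadget.depthBound 2 (k + 1) ≤ D →
      ((chordalGadget k).treeOfGadgets D).Connected ∧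
      IsChordalGraph ((chordalGadget k).treeOfGadgets D) ∧
      ¬ AdmitsCollectiveTreeSpanners ((chordalGadget k).treeOfGadgets D) k 2 := fun D hD =>
    ⟨(chordalGadget k).treeOfGadgets_connected D,
      (chordalGadget k).isChordalGraph_treeOfGadgets hch D,
      (chordalGadget k).not_admitsCollectiveTreeSpanners_treeOfGadgets hgad hD⟩
  exact ⟨⟨_, (chordalGadget k).finite_treeVertex _, _, main _ le_rfl⟩, hch, hgad, _, main⟩
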